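/- Let $N\in\mathbb{N}$ and $p\in(1,\infty)$. For a non-empty open set $\Omega\subset\mathbb{R}^N$ let $W^{1,p}(\Omega)$ be the space of all $\mathsf u\in L^p(\Omega)$ whose weak first-order partial derivatives belong to $L^p(\Omega)$, with the norm $\|\mathsf u\|_{W^{1,p}(\Omega)}^p=\|\mathsf u\|_{L^p(\Omega)}^p+\sum_{i=1}^N\|\partial_i\mathsf u\|_{L^p(\Omega)}^p$, and let $\tilde W^{1,p}(\Omega)$ be the closure in $W^{1,p}(\Omega)$ of the set of those elements of $W^{1,p}(\Omega)$ that are restrictions to $\Omega$ of continuous functions on $\overline\Omega$ with compact support. For $A\subset\overline\Omega$ let \[ \operatorname{Cap}_{p,\Omega}(A):=\inf\left\{\|\mathsf u\|_{W^{1,p}(\Omega)}^p:\ \mathsf u\in\tilde W^{1,p}(\Omega),\ \mathsf u\ge 1 \text{ a.e. on } O\cap\Omega \text{ for some } O\supset A \text{ open in } \overline\Omega\right\}\in[0,\infty]. \] A function $u:D\to\mathbb{R}$ on a set $D\subset\overline\Omega$ is called $\operatorname{Cap}_{p,\Omega}$-quasi continuous if for every $\varepsilon>0$ there is a set $O$,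 open in $\overline\Omega$, with $\operatorname{Cap}_{p,\Omega}(O)<\varepsilon$ such that the restriction of $u$ to $D\setminus O$ is continuous. Let $U\subset V\subset\mathbb{R}^N$ be non-empty open sets and let $u:U\to\mathbb{R}$ be a function. Then $u$ is $\operatorname{Cap}_{p,U}$-quasi continuous if and only if $u$ is $\operatorname{Cap}_{p,V}$-quasi continuous. -/

import Mathlib

open MeasureTheory TopologicalSpace
open scoped ENNReal Distributions CompactlySupported

noncomputable section

namespace RelCap

/-- `g` is the weak `i`-th partial derivative of `u` on the open set `Ω ⊆ ℝ^N`. It is only used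
for `u, g ∈ L^p(Ω)`, where all the integrals below converge. -/
def HasWeakPartialDeriv {N : ℕ} (Ω : Opens (EuclideanSpace ℝ (Fin N))) (i : Fin N)
    (u g : EuclideanSpace ℝ (Fin N) → ℝ) : Prop :=
  ∀ φ : 𝓓(Ω, ℝ),
    ∫ x in (Ω : Set (EuclideanSpace ℝ (Fin N))),
        u x * fderiv ℝ φ x (EuclideanSpace.single i (1 : ℝ)) =
      - ∫ x in (Ω : Set (EuclideanSpace ℝ (Fin N))), g x * φ x

/-- The space `L^p(Ω)^{N+1}` with the norm `(∑ j, ‖w j‖_{L^p(Ω)}^p)^{1/p}`. The index `none` stands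
for the multi-index `0`, and `some i` for the `i`-th unit multi-index. -/
abbrev LpJet {N : ℕ} (p : ℝ≥0∞) (Ω : Opens (EuclideanSpace ℝ (Fin N))) : Type :=
  PiLp p (fun _ : Option (Fin N) =>
    Lp ℝ p ((volume : Measure (EuclideanSpace ℝ (Fin N))).restrict Ω))

/-- The Sobolev space `W^{1,p}(Ω)`. A function `u` is represented by the tuple
`(u, ∂₁u, …, ∂_N u)` of its weak derivatives of order at most one, which `u` determines, so that
the norm inherited from `L^p(Ω)^{N+1}` is the one of `W^{1,p}(Ω)`. -/
def sobolev {N : ℕ} (p : ℝ≥0∞) (Ω : Opens (EuclideanSpace ℝ (Fin N))) : Set (LpJet p Ω) :=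
  {w | ∀ i : Fin N, HasWeakPartialDeriv Ω i (w none) (w (some i))}

/-- `W^{1,p}(Ω) ∩ C_c(closure Ω)`: the elements of `W^{1,p}(Ω)` that are restrictions to `Ω` of
continuous functions on `closure Ω` with compact support. -/
def sobolevCc {N : ℕ} (p : ℝ≥0∞) (Ω : Opens (EuclideanSpace ℝ (Fin N))) : Set (LpJet p Ω) :=
  {w | w ∈ sobolev p Ω ∧
    ∃ f : C_c(closure (Ω : Set (EuclideanSpace ℝ (Fin N))), ℝ),
      ∀ᵐ x ∂((volume : Measure (EuclideanSpace ℝ (Fin N))).restrict Ω),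
        ∀ hx : x ∈ closure (Ω : Set (EuclideanSpace ℝ (Fin N))), w none x = f ⟨x, hx⟩}

/-- The closure of `W^{1,p}(Ω) ∩ C_c(closure Ω)` in `W^{1,p}(Ω)`. -/
def sobolevTilde {N : ℕ} (p : ℝ≥0∞) [Fact (1 ≤ p)] (Ω : Opens (EuclideanSpace ℝ (Fin N))) :
    Set (LpJet p Ω) :=
  sobolev p Ω ∩ closure (sobolevCc p Ω)

/-- `O` is a relatively open subset of `closure Ω`. -/
def IsOpenInClosure {N : ℕ} (Ω : Opens (EuclideanSpace ℝ (Fin N)))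
    (O : Set (EuclideanSpace ℝ (Fin N))) : Prop :=
  ∃ G : Set (EuclideanSpace ℝ (Fin N)), IsOpen G ∧ O = G ∩ closure (Ω : Set _)

/-- The functions in the closure of `W^{1,p}(Ω) ∩ C_c(closure Ω)` that are at least `1` almost
everywhere on `O ∩ Ω` for some relatively open subset `O` of `closure Ω` containing `A`. -/
def admissible {N : ℕ} (p : ℝ≥0∞) [Fact (1 ≤ p)] (Ω : Opens (EuclideanSpace ℝ (Fin N)))
    (A : Set (EuclideanSpace ℝ (Fin N))) : Set (LpJet p Ω) :=
  {w | w ∈ sobolevTilde p Ω ∧ ∃ O : Set (EuclideanSpace ℝ (Fin N)),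
    IsOpenInClosure Ω O ∧ A ⊆ O ∧
      ∀ᵐ x ∂((volume : Measure (EuclideanSpace ℝ (Fin N))).restrict (O ∩ Ω)), 1 ≤ w none x}

/-- The relative `p`-capacity of `A ⊆ closure Ω` with respect to `Ω`
(`∞` if there is no admissible function). -/
def relCap {N : ℕ} (p : ℝ≥0∞) [Fact (1 ≤ p)] (Ω : Opens (EuclideanSpace ℝ (Fin N)))
    (A : Set (EuclideanSpace ℝ (Fin N))) : ℝ≥0∞ :=
  ⨅ w ∈ admissible p Ω A, ‖w‖ₑ ^ p.toReal

/-- Quasi continuity, with respect to the relative `p`-capacity of `Ω`, of a real function `u`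
on a set `D ⊆ closure Ω`. -/
def QuasiContinuous {N : ℕ} (p : ℝ≥0∞) [Fact (1 ≤ p)] (Ω : Opens (EuclideanSpace ℝ (Fin N)))
    {D : Set (EuclideanSpace ℝ (Fin N))} (u : D → ℝ) : Prop :=
  ∀ ε : ℝ≥0∞, 0 < ε → ∃ O : Set (EuclideanSpace ℝ (Fin N)),
    IsOpenInClosure Ω O ∧ relCap p Ω O < ε ∧
      ContinuousOn u {x : D | (x : EuclideanSpace ℝ (Fin N)) ∉ O}

end RelCap

end

/-! ### Mollification and the chain rule for weak derivatives. -/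

section ChainRule

open Filter Topology ContinuousLinearMap
open scoped Convolution

/-! Passing from a set to a smaller one is easy: restricting an admissible function keeps it
admissible and does not increase the norm by more than a constant (`QuasiContinuous.restrict`). For
the converse it therefore suffices to go from `U` up to the whole space and then restrict to `V`.

Since continuity on `U` is local, `U` is covered by countably many balls whose doubles stay in `U`.
On the `n`-th ball the exceptional set may be chosen with capacity so small that multiplying an
admissible function by a cutoff `η n` and extending by zero still costs only a summable amount. The
union of the localized exceptional sets is then exceptional for the whole space, with the sum of the
localized functions as admissible function (`QuasiContinuous.extend_top`).

The summands must be nonnegative for the sum to stay at least `1` on the union. Taking absolute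
values of `η w` directly would require the lattice structure of the Sobolev space. Instead `w` is
written as a fast series of continuous functions `h k`, each `η * h k` is replaced by a smooth
version of its absolute value, and these are added up (`IsCutoff.exists_localization`). Only a `C^1`
chain rule for continuous functions is then needed (`HasWeakDirDeriv.comp`), at the price of a
constant factor in the norm. -/

theorem ContDiffBump.exists_seq_tendsto_rOut {E : Type*} [NormedAddCommGroup E] :
    ∃ ρ : ℕ → ContDiffBump (0 : E), Tendsto (fun n => (ρ n).rOut) atTop (𝓝 0) :=
  ⟨fun n => ⟨1 / (n + 1 : ℝ) / 2, 1 / (n + 1 : ℝ), by positivity, half_lt_self (by positivity)⟩,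
    tendsto_one_div_add_atTop_nhds_zero_nat⟩

variable {E : Type*} [NormedAddCommGroup E] [NormedSpace ℝ E] [FiniteDimensional ℝ E]
  [MeasurableSpace E] [BorelSpace E] {μ : Measure E} [μ.IsAddHaarMeasure]

/-- `g` is the distributional derivative of `v` in the direction `e` on the whole space. -/
def HasWeakDirDeriv (μ : Measure E) (e : E) (v g : E → ℝ) : Prop :=
  ∀ φ : E → ℝ, ContDiff ℝ (⊤ : ℕ∞) φ → HasCompactSupport φ →
    ∫ x, v x * fderiv ℝ φ x e ∂μ = -∫ x, g x * φ x ∂μ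

/-- Mollification turns a weak derivative into a classical one. -/
theorem HasWeakDirDeriv.fderiv_convolution {e : E} {v g ρ : E → ℝ} (h : HasWeakDirDeriv μ e v g)
    (hv : LocallyIntegrable v μ) (hρ : ContDiff ℝ (⊤ : ℕ∞) ρ) (hρc : HasCompactSupport ρ) (x : E) :
    fderiv ℝ (ρ ⋆[lsmul ℝ ℝ, μ] v) x e = (ρ ⋆[lsmul ℝ ℝ, μ] g) x := by
  have hρ1 : ContDiff ℝ 1 ρ := hρ.of_le (by exact_mod_cast le_top)
  have h1 := (hρc.hasFDerivAt_convolution_left (lsmul ℝ ℝ) hρ1 hv x).fderiv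
  rw [h1, convolution_eq_swap, convolution_eq_swap]
  have hex : ConvolutionExistsAt (fderiv ℝ ρ) v x ((lsmul ℝ ℝ).precompL E) μ :=
    (hρc.fderiv ℝ).convolutionExists_left _ (hρ1.continuous_fderiv one_ne_zero) hv x
  have hi := hex.integrable_swap
  rw [ContinuousLinearMap.integral_apply hi]
  have hd : ∀ t, fderiv ℝ (fun t => ρ (x - t)) t e = - fderiv ℝ ρ (x - t) e := by
    intro t
    have h2 : HasFDerivAt (fun t => ρ (x - t))
        ((fderiv ℝ ρ (x - t)).comp (-ContinuousLinearMap.id ℝ E)) t := by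
      have h3 : HasFDerivAt ρ (fderiv ℝ ρ (x - t)) (x - t) :=
        (hρ1.differentiable one_ne_zero _).hasFDerivAt
      exact h3.comp t ((hasFDerivAt_id t).const_sub x)
    rw [h2.fderiv]; simp
  -- The reflected translate of the kernel serves as test function; the sign from the reflection
  -- cancels the one in the weak derivative.
  have h3 := h (fun t => ρ (x - t)) (hρ.comp (contDiff_const.sub contDiff_id))
    (hρc.comp_homeomorph (Homeomorph.subLeft x))
  simp only [hd, mul_neg, integral_neg, neg_inj] at h3
  simpa [mul_comm] using h3

/-- The kernel is a probability density. The bound does not depend on `ρ`, so it yields majorants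
for dominated convergence. -/
theorem ContDiffBump.abs_convolution_le (ρ : ContDiffBump (0 : E)) {v : E → ℝ} {M : ℝ}
    (hM : ∀ x, |v x| ≤ M) (x : E) : |(ρ.normed μ ⋆[lsmul ℝ ℝ, μ] v) x| ≤ M := by
  have : ∀ t, ‖lsmul ℝ ℝ (ρ.normed μ t) (v (x - t))‖ ≤ ρ.normed μ t * M := fun t => by
    simp only [lsmul_apply, smul_eq_mul, norm_mul, Real.norm_eq_abs,
      abs_of_nonneg (ρ.nonneg_normed t)]
    exact mul_le_mul_of_nonneg_left (hM _) (ρ.nonneg_normed t)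
  have h := norm_integral_le_of_norm_le (ρ.integrable_normed.mul_const M)
    (Eventually.of_forall this)
  rwa [integral_mul_const, ρ.integral_normed, one_mul] at h

/-- Convolution with an even kernel is symmetric with respect to the `L²` pairing. -/
theorem ContDiffBump.integral_mul_convolution (ρ : ContDiffBump (0 : E)) {ψ g : E → ℝ}
    (hψ : Integrable ψ μ) (hg : Integrable g μ) :
    ∫ x, ψ x * (ρ.normed μ ⋆[lsmul ℝ ℝ, μ] g) x ∂μ =
      ∫ y, g y * (ρ.normed μ ⋆[lsmul ℝ ℝ, μ] ψ) y ∂μ := by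
  obtain ⟨C, hC⟩ := ρ.continuous_normed (μ := μ).bounded_above_of_compact_support
    ρ.hasCompactSupport_normed
  have hint : Integrable (fun z : E × E => ρ.normed μ (z.1 - z.2) * (ψ z.1 * g z.2))
      (μ.prod μ) := by
    refine (hψ.mul_prod hg).bdd_mul (c := C) ?_ (Eventually.of_forall fun z => hC _)
    exact (ρ.continuous_normed.comp (continuous_fst.sub continuous_snd)).aestronglyMeasurable
  have hswap := integral_integral_swap (f := fun x y => ρ.normed μ (x - y) * (ψ x * g y)) hint
  simp only [convolution_eq_swap, lsmul_apply, smul_eq_mul, ← integral_const_mul]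
  convert hswap using 1
  · congr 1; ext x; congr 1; ext y; ring
  · congr 1; ext x; congr 1; ext y
    rw [← ρ.normed_neg, neg_sub]; ring

/-- Convergence is joint in the index and the point because the mollified functions are later
mollified again, with the same index. -/
theorem ContDiffBump.tendsto_uncurry_convolution {ρ : ℕ → ContDiffBump (0 : E)}
    (hρ : Tendsto (fun n => (ρ n).rOut) atTop (𝓝 0)) {v : E → ℝ} (hv : Continuous v) (x : E) :
    Tendsto (Function.uncurry fun n => (ρ n).normed μ ⋆[lsmul ℝ ℝ, μ] v) (atTop ×ˢ 𝓝 x)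
      (𝓝 (v x)) := by
  have h1 : Tendsto (fun z : ℕ × E => (ρ z.1).rOut) (atTop ×ˢ 𝓝 x) (𝓝 0) := hρ.comp tendsto_fst
  have h2 : Tendsto (Function.uncurry fun _ : ℕ × E => v) ((atTop ×ˢ 𝓝 x) ×ˢ 𝓝 x) (𝓝 (v x)) :=
    (hv.tendsto x).comp tendsto_snd
  exact ContDiffBump.convolution_tendsto_right h1
    (Eventually.of_forall fun _ => hv.aestronglyMeasurable) h2 tendsto_snd

/-- The chain rule for the weak derivative of a continuous function with compact support. -/
theorem HasWeakDirDeriv.comp {e : E} {v g : E → ℝ} (h : HasWeakDirDeriv μ e v g)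
    (hv : Continuous v) (hvc : HasCompactSupport v) (hg : Integrable g μ) {Ψ : ℝ → ℝ}
    (hΨ : ContDiff ℝ 1 Ψ) (hΨ1 : ∀ t, |Ψ t| ≤ |t|) (hΨ' : ∀ t, |deriv Ψ t| ≤ 1) :
    HasWeakDirDeriv μ e (fun x => Ψ (v x)) (fun x => deriv Ψ (v x) * g x) := by
  intro φ hφ hφc
  have hφ1 : ContDiff ℝ 1 φ := hφ.of_le (by exact_mod_cast le_top)
  have hΨ'c : Continuous (deriv Ψ) := hΨ.continuous_deriv le_rfl
  obtain ⟨Mv, hMv⟩ := hv.bounded_above_of_compact_support hvc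
  obtain ⟨Mφ, hMφ⟩ := hφ.continuous.bounded_above_of_compact_support hφc
  obtain ⟨ρ, hρ⟩ := ContDiffBump.exists_seq_tendsto_rOut (E := E)
  let V : ℕ → E → ℝ := fun n => (ρ n).normed μ ⋆[lsmul ℝ ℝ, μ] v
  have hvl : LocallyIntegrable v μ := hv.locallyIntegrable
  have hVd : ∀ n, ContDiff ℝ 1 (V n) := fun n =>
    (ρ n).hasCompactSupport_normed.contDiff_convolution_left _ (ρ n).contDiff_normed hvl
  have hVx : ∀ x, Tendsto (Function.uncurry V) (atTop ×ˢ 𝓝 x) (𝓝 (v x)) :=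
    ContDiffBump.tendsto_uncurry_convolution hρ hv
  have hVp : ∀ x, Tendsto (fun n => V n x) atTop (𝓝 (v x)) :=
    ContDiffBump.convolution_tendsto_right_of_continuous hρ hv
  have hVe : ∀ n x, fderiv ℝ (V n) x e = ((ρ n).normed μ ⋆[lsmul ℝ ℝ, μ] g) x := by
    intro n x
    exact h.fderiv_convolution hvl (ρ n).contDiff_normed (ρ n).hasCompactSupport_normed x
  let ψ : ℕ → E → ℝ := fun n x => deriv Ψ (V n x) * φ x
  have hψc : ∀ n, Continuous (ψ n) := fun n =>
    (hΨ'c.comp (hVd n).continuous).mul hφ.continuous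
  have hψi : ∀ n, Integrable (ψ n) μ := fun n =>
    (hψc n).integrable_of_hasCompactSupport hφc.mul_left
  have hψb : ∀ n x, |ψ n x| ≤ Mφ := fun n x => by
    simp only [ψ, abs_mul]
    exact (mul_le_of_le_one_left (abs_nonneg _) (hΨ' _)).trans (hMφ x)
  -- Classical integration by parts for the mollified function. The mollifier is then moved from `g`
  -- to the bounded factor `ψ n`, so that the limit needs only the integrability of `g` and the
  -- fixed majorant `‖g‖ * Mφ`.
  have hcl : ∀ n, ∫ x, Ψ (V n x) * fderiv ℝ φ x e ∂μ =
      -∫ y, g y * ((ρ n).normed μ ⋆[lsmul ℝ ℝ, μ] ψ n) y ∂μ := by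
    intro n
    have hf : ContDiff ℝ 1 (fun x => Ψ (V n x)) := hΨ.comp (hVd n)
    have hfd : ∀ x, fderiv ℝ (fun x => Ψ (V n x)) x e * φ x =
        ψ n x * ((ρ n).normed μ ⋆[lsmul ℝ ℝ, μ] g) x := by
      intro x
      have := ((hΨ.differentiable one_ne_zero (V n x)).hasDerivAt.comp_hasFDerivAt x
        ((hVd n).differentiable one_ne_zero x).hasFDerivAt).fderiv
      rw [Function.comp_def] at this
      rw [this]
      simp [ψ, hVe]; ring
    rw [integral_mul_fderiv_eq_neg_fderiv_mul_of_integrable]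
    · simp_rw [hfd]
      rw [(ρ n).integral_mul_convolution (hψi n) hg]
    · exact (((hf.continuous_fderiv one_ne_zero).clm_apply continuous_const).mul
        hφ.continuous).integrable_of_hasCompactSupport hφc.mul_left
    · refine (hf.continuous.mul ((hφ1.continuous_fderiv one_ne_zero).clm_apply
        continuous_const)).integrable_of_hasCompactSupport (hφc.fderiv_apply ℝ e).mul_left
    · exact (hf.continuous.mul hφ.continuous).integrable_of_hasCompactSupport hφc.mul_left
    · exact fun x _ => hf.differentiable one_ne_zero x
    · exact fun x _ => hφ1.differentiable one_ne_zero x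
  have hL : Tendsto (fun n => ∫ x, Ψ (V n x) * fderiv ℝ φ x e ∂μ) atTop
      (𝓝 (∫ x, Ψ (v x) * fderiv ℝ φ x e ∂μ)) := by
    have hφe : Continuous fun x => fderiv ℝ φ x e :=
      (hφ1.continuous_fderiv one_ne_zero).clm_apply continuous_const
    refine tendsto_integral_of_dominated_convergence (fun x => Mv * ‖fderiv ℝ φ x e‖) ?_ ?_ ?_ ?_
    · exact fun n => ((hΨ.continuous.comp (hVd n).continuous).mul hφe).aestronglyMeasurable
    · exact ((hφe.integrable_of_hasCompactSupport (hφc.fderiv_apply ℝ e)).norm).const_mul _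
    · refine fun n => Eventually.of_forall fun x => ?_
      rw [norm_mul]
      exact mul_le_mul_of_nonneg_right
        ((hΨ1 _).trans ((ρ n).abs_convolution_le hMv x)) (norm_nonneg _)
    · exact Eventually.of_forall fun x =>
        ((hΨ.continuous.tendsto _).comp (hVp x)).mul_const _
  have hR : Tendsto (fun n => -∫ y, g y * ((ρ n).normed μ ⋆[lsmul ℝ ℝ, μ] ψ n) y ∂μ) atTop
      (𝓝 (-∫ y, deriv Ψ (v y) * g y * φ y ∂μ)) := by
    refine (tendsto_integral_of_dominated_convergence (fun x => ‖g x‖ * Mφ) ?_ ?_ ?_ ?_).neg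
    · refine fun n => hg.aestronglyMeasurable.mul ?_
      exact ((ρ n).hasCompactSupport_normed.continuous_convolution_left _
        (ρ n).continuous_normed (hψc n).locallyIntegrable).aestronglyMeasurable
    · exact hg.norm.mul_const _
    · refine fun n => Eventually.of_forall fun x => ?_
      rw [norm_mul]
      exact mul_le_mul_of_nonneg_left ((ρ n).abs_convolution_le (hψb n) x) (norm_nonneg _)
    · refine Eventually.of_forall fun x => ?_
      have : Tendsto (fun n => ((ρ n).normed μ ⋆[lsmul ℝ ℝ, μ] ψ n) x) atTop
          (𝓝 (deriv Ψ (v x) * φ x)) := by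
        refine ContDiffBump.convolution_tendsto_right hρ
          (Eventually.of_forall fun n => (hψc n).aestronglyMeasurable) ?_ tendsto_const_nhds
        exact ((hΨ'c.tendsto _).comp (hVx x)).mul ((hφ.continuous.tendsto x).comp tendsto_snd)
      convert this.const_mul (g x) using 2
      ring
  simp_rw [hcl] at hL
  exact tendsto_nhds_unique hL hR

end ChainRule

/-! ### Sobolev jets, and restriction to smaller open sets. -/

noncomputable section

namespace RelCap

open Filter Topology

variable {N : ℕ} {p : ℝ≥0∞} [Fact (1 ≤ p)] {Ω U V : Opens (EuclideanSpace ℝ (Fin N))}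

section Pairing

variable {E : Type*} [TopologicalSpace E] [MeasurableSpace E] [OpensMeasurableSpace E]

/-- Integration against a continuous function with compact support is a continuous functional
on `L^p`. -/
theorem exists_clm_integral_mul [SecondCountableTopology E] [R1Space E] (μ : Measure E)
    [IsFiniteMeasureOnCompacts μ] {ψ : E → ℝ} (hψ : Continuous ψ) (hψc : HasCompactSupport ψ) :
    ∃ L : Lp ℝ p μ →L[ℝ] ℝ, ∀ f : Lp ℝ p μ, L f = ∫ x, f x * ψ x ∂μ := by
  -- The conjugate exponent; a continuous function with compact support lies in every `L^q`, so
  -- Hölder applies.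
  have : ENNReal.HolderConjugate p (1 - p⁻¹)⁻¹ := .inv_one_sub_inv' Fact.out
  have : Fact (1 ≤ (1 - p⁻¹)⁻¹) := ⟨ENNReal.HolderConjugate.one_le (1 - p⁻¹)⁻¹ p⟩
  have hm : MemLp ψ (1 - p⁻¹)⁻¹ μ := hψ.memLp_of_hasCompactSupport hψc
  refine ⟨((ContinuousLinearMap.mul ℝ ℝ).lpPairing μ p (1 - p⁻¹)⁻¹).flip (hm.toLp ψ), fun f => ?_⟩
  rw [ContinuousLinearMap.flip_apply, ContinuousLinearMap.lpPairing_eq_integral]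
  refine integral_congr_ae ?_
  filter_upwards [hm.coeFn_toLp] with x hx
  simp [hx]

theorem integrable_lp_mul (μ : Measure E) [IsFiniteMeasureOnCompacts μ] {ψ : E → ℝ}
    (hψ : Continuous ψ) (hψc : HasCompactSupport ψ) (f : Lp ℝ p μ) :
    Integrable (fun x => f x * ψ x) μ := by
  have : ENNReal.HolderConjugate p (1 - p⁻¹)⁻¹ := .inv_one_sub_inv' Fact.out
  have hm : MemLp ψ (1 - p⁻¹)⁻¹ μ := hψ.memLp_of_hasCompactSupport hψc
  exact (Lp.memLp f).integrable_mul hm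

end Pairing

theorem continuous_fderiv_testFunction (φ : 𝓓(Ω, ℝ)) (e : EuclideanSpace ℝ (Fin N)) :
    Continuous fun x => fderiv ℝ φ x e :=
  (φ.contDiff.continuous_fderiv (by simp)).clm_apply continuous_const

theorem hasCompactSupport_fderiv_testFunction (φ : 𝓓(Ω, ℝ)) (e : EuclideanSpace ℝ (Fin N)) :
    HasCompactSupport fun x => fderiv ℝ φ x e :=
  φ.hasCompactSupport.fderiv_apply ℝ e

/-- The defect of the integration by parts formula, as a continuous functional on jets. -/
theorem exists_clm_defect (φ : 𝓓(Ω, ℝ)) (i : Fin N) :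
    ∃ L : LpJet p Ω →L[ℝ] ℝ, ∀ w : LpJet p Ω, L w =
      (∫ x in (Ω : Set (EuclideanSpace ℝ (Fin N))),
        w none x * fderiv ℝ φ x (EuclideanSpace.single i (1 : ℝ))) +
      ∫ x in (Ω : Set (EuclideanSpace ℝ (Fin N))), w (some i) x * φ x := by
  obtain ⟨L₁, h₁⟩ := exists_clm_integral_mul (p := p)
    ((volume : Measure (EuclideanSpace ℝ (Fin N))).restrict Ω)
    (continuous_fderiv_testFunction φ (EuclideanSpace.single i 1))
    (hasCompactSupport_fderiv_testFunction φ _)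
  obtain ⟨L₂, h₂⟩ := exists_clm_integral_mul (p := p)
    ((volume : Measure (EuclideanSpace ℝ (Fin N))).restrict Ω) φ.continuous φ.hasCompactSupport
  refine ⟨L₁.comp (PiLp.proj p _ none) + L₂.comp (PiLp.proj p _ (some i)), fun w => ?_⟩
  simp [h₁, h₂]

variable (p Ω) in
/-- The Sobolev space as a submodule of the space of jets. -/
def sobolevSubmodule : Submodule ℝ (LpJet p Ω) :=
  ⨅ (i : Fin N) (φ : 𝓓(Ω, ℝ)), LinearMap.ker (exists_clm_defect (p := p) φ i).choose.toLinearMap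

theorem mem_sobolevSubmodule {w : LpJet p Ω} : w ∈ sobolevSubmodule p Ω ↔ w ∈ sobolev p Ω := by
  simp only [sobolevSubmodule, Submodule.mem_iInf, LinearMap.mem_ker, sobolev,
    HasWeakPartialDeriv, Set.mem_ofPred_eq]
  refine forall_congr' fun i => forall_congr' fun φ => ?_
  have := (exists_clm_defect (p := p) φ i).choose_spec w
  rw [eq_neg_iff_add_eq_zero, ← this]
  rfl

/-- An intersection of kernels of the continuous defect functionals. Consequently the closure in
`sobolevTilde` may be taken among all jets. -/
theorem isClosed_sobolev : IsClosed (sobolev p Ω) := by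
  have : sobolev p Ω = ⋂ (i : Fin N) (φ : 𝓓(Ω, ℝ)),
      (exists_clm_defect (p := p) φ i).choose ⁻¹' {0} := by
    ext w
    rw [← mem_sobolevSubmodule]
    simp [sobolevSubmodule, Submodule.mem_iInf]
  rw [this]
  exact isClosed_iInter fun i => isClosed_iInter fun φ =>
    isClosed_singleton.preimage (ContinuousLinearMap.continuous _)

theorem sobolevTilde_eq : sobolevTilde p Ω = closure (sobolevCc p Ω) :=
  Set.inter_eq_right.2 (closure_minimal (fun _ hw => hw.1) isClosed_sobolev)

variable (p Ω) in
/-- `W^{1,p}(Ω) ∩ C_c(closure Ω)` as an additive group. -/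
def sobolevCcSubgroup : AddSubgroup (LpJet p Ω) where
  carrier := sobolevCc p Ω
  zero_mem' := by
    refine ⟨mem_sobolevSubmodule.1 (zero_mem _), 0, ?_⟩
    filter_upwards [Lp.coeFn_zero ℝ p
      ((volume : Measure (EuclideanSpace ℝ (Fin N))).restrict Ω)] with x hx _
    simpa using hx
  add_mem' := by
    rintro a b ⟨ha, f, hf⟩ ⟨hb, g, hg⟩
    refine ⟨mem_sobolevSubmodule.1
      (add_mem (mem_sobolevSubmodule.2 ha) (mem_sobolevSubmodule.2 hb)), f + g, ?_⟩
    filter_upwards [hf, hg, Lp.coeFn_add (a none) (b none)] with x h1 h2 h3 hx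
    simpa [h1 hx, h2 hx] using h3
  neg_mem' := by
    rintro a ⟨ha, f, hf⟩
    refine ⟨mem_sobolevSubmodule.1 (neg_mem (mem_sobolevSubmodule.2 ha)), -f, ?_⟩
    filter_upwards [hf, Lp.coeFn_neg (a none)] with x h1 h3 hx
    simpa [h1 hx] using h3

variable (p Ω) in
/-- A jet is controlled by a uniform bound on its components. -/
theorem exists_norm_jet_le : ∃ K : ℝ, 0 ≤ K ∧ ∀ (w : LpJet p Ω) (c : ℝ),
    (∀ j, ‖w j‖ ≤ c) → ‖w‖ ≤ K * c := by
  let L := (PiLp.continuousLinearEquiv p ℝ (fun _ : Option (Fin N) =>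
    Lp ℝ p ((volume : Measure (EuclideanSpace ℝ (Fin N))).restrict Ω))).symm.toContinuousLinearMap
  refine ⟨‖L‖, norm_nonneg _, fun w c hc => ?_⟩
  have h := L.le_opNorm (WithLp.ofLp w)
  refine h.trans (mul_le_mul_of_nonneg_left ?_ (norm_nonneg _))
  exact (pi_norm_le_iff_of_nonempty _).2 hc

/-- Restriction of `L^p` functions to a smaller measure. -/
theorem exists_clm_lp_restrict {α : Type*} [MeasurableSpace α] {μ ν : Measure α} (h : μ ≤ ν) :
    ∃ T : Lp ℝ p ν →L[ℝ] Lp ℝ p μ, ∀ f : Lp ℝ p ν, T f =ᵐ[μ] f := by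
  have hm : ∀ f : Lp ℝ p ν, MemLp f p μ := fun f => (Lp.memLp f).mono_measure h
  let T : Lp ℝ p ν →ₗ[ℝ] Lp ℝ p μ :=
    { toFun := fun f => (hm f).toLp f
      map_add' := fun f g => by
        ext1
        filter_upwards [(hm (f + g)).coeFn_toLp, (hm f).coeFn_toLp, (hm g).coeFn_toLp,
          Lp.coeFn_add ((hm f).toLp f) ((hm g).toLp g),
          (Measure.absolutelyContinuous_of_le h).ae_le (Lp.coeFn_add f g)] with x h1 h2 h3 h4 h5
        simp_all
      map_smul' := fun c f => by
        ext1
        filter_upwards [(hm (c • f)).coeFn_toLp, (hm f).coeFn_toLp,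
          Lp.coeFn_smul c ((hm f).toLp f),
          (Measure.absolutelyContinuous_of_le h).ae_le (Lp.coeFn_smul c f)] with x h1 h2 h3 h4
        simp_all }
  refine ⟨T.mkContinuous 1 fun f => ?_, fun f => (hm f).coeFn_toLp⟩
  rw [one_mul]
  change ‖(hm f).toLp f‖ ≤ ‖f‖
  rw [Lp.norm_toLp, Lp.norm_def]
  exact ENNReal.toReal_mono (Lp.eLpNorm_ne_top f) (eLpNorm_mono_measure _ h)

variable (p) in
/-- Restriction of jets to a smaller open set. -/
theorem exists_clm_jet_restrict (h : U ≤ V) : ∃ T : LpJet p V →L[ℝ] LpJet p U,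
    ∀ (w : LpJet p V) j,
      T w j =ᵐ[(volume : Measure (EuclideanSpace ℝ (Fin N))).restrict U] w j := by
  obtain ⟨R, hR⟩ := exists_clm_lp_restrict (p := p)
    (Measure.restrict_mono (μ := (volume : Measure (EuclideanSpace ℝ (Fin N)))) h le_rfl)
  refine ⟨(PiLp.continuousLinearEquiv p ℝ _).symm.toContinuousLinearMap.comp
    (ContinuousLinearMap.pi fun j => R.comp (PiLp.proj p _ j)), fun w j => ?_⟩
  exact hR (w j)

/-- A test function on `U` is also one on `V`, and its support in `U` reduces the integrals over `V`
to integrals over `U`. -/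
theorem sobolev_restrict {p : ℝ≥0∞} (h : U ≤ V) {w : LpJet p V} {w' : LpJet p U}
    (hw : w ∈ sobolev p V)
    (hww : ∀ j, w' j =ᵐ[(volume : Measure (EuclideanSpace ℝ (Fin N))).restrict U] w j) :
    w' ∈ sobolev p U := by
  intro i φ
  let φ' : 𝓓(V, ℝ) := ⟨φ, φ.contDiff, φ.hasCompactSupport, φ.tsupport_subset.trans h⟩
  have key := hw i φ'
  have h0 : ∀ x, x ∉ (U : Set (EuclideanSpace ℝ (Fin N))) → φ x = 0 := fun x hx =>
    image_eq_zero_of_notMem_tsupport fun hx' => hx (φ.tsupport_subset hx')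
  have h1 : ∀ x, x ∉ (U : Set (EuclideanSpace ℝ (Fin N))) → fderiv ℝ φ x = 0 := fun x hx =>
    image_eq_zero_of_notMem_tsupport fun hx' =>
      hx (φ.tsupport_subset (tsupport_fderiv_subset ℝ hx'))
  change ∫ x in (V : Set (EuclideanSpace ℝ (Fin N))),
        w none x * fderiv ℝ φ x (EuclideanSpace.single i (1 : ℝ)) =
      - ∫ x in (V : Set (EuclideanSpace ℝ (Fin N))), w (some i) x * φ x at key
  rw [setIntegral_eq_of_subset_of_forall_sdiff_eq_zero V.isOpen.measurableSet h
      (fun x hx => by simp [h1 x hx.2]),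
    setIntegral_eq_of_subset_of_forall_sdiff_eq_zero V.isOpen.measurableSet h
      (fun x hx => by simp [h0 x hx.2])] at key
  have e1 : ∫ x in (U : Set (EuclideanSpace ℝ (Fin N))),
      w' none x * fderiv ℝ φ x (EuclideanSpace.single i (1 : ℝ)) =
      ∫ x in (U : Set (EuclideanSpace ℝ (Fin N))),
      w none x * fderiv ℝ φ x (EuclideanSpace.single i (1 : ℝ)) :=
    integral_congr_ae ((hww none).mul EventuallyEq.rfl)
  have e2 : ∫ x in (U : Set (EuclideanSpace ℝ (Fin N))), w' (some i) x * φ x =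
      ∫ x in (U : Set (EuclideanSpace ℝ (Fin N))), w (some i) x * φ x :=
    integral_congr_ae ((hww (some i)).mul EventuallyEq.rfl)
  rw [e1, e2, key]

/-- `closure U` is closed in `closure V`, so the support of the continuous representative stays
compact under restriction. -/
theorem sobolevCc_restrict {p : ℝ≥0∞} (h : U ≤ V) {w : LpJet p V} {w' : LpJet p U}
    (hw : w ∈ sobolevCc p V)
    (hww : ∀ j, w' j =ᵐ[(volume : Measure (EuclideanSpace ℝ (Fin N))).restrict U] w j) :
    w' ∈ sobolevCc p U := by
  obtain ⟨hs, f, hf⟩ := hw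
  refine ⟨sobolev_restrict h hs hww, ?_⟩
  have hcl : closure (U : Set (EuclideanSpace ℝ (Fin N))) ⊆ closure V := closure_mono h
  have hemb : IsClosedEmbedding (Set.inclusion hcl) :=
    ⟨.inclusion hcl, by
      rw [Set.range_inclusion]
      exact isClosed_closure.preimage continuous_subtype_val⟩
  refine ⟨⟨⟨f ∘ Set.inclusion hcl, f.continuous.comp (continuous_inclusion hcl)⟩,
    f.hasCompactSupport.comp_isClosedEmbedding hemb⟩, ?_⟩
  have hf' := ae_mono (Measure.restrict_mono
    (μ := (volume : Measure (EuclideanSpace ℝ (Fin N)))) h le_rfl) hf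
  filter_upwards [hf', hww none] with x h1 h2 hx
  rw [h2, h1 (hcl hx)]
  rfl

/-- Quasi continuity in terms of admissible functions of small norm. -/
theorem quasiContinuous_iff (hp : p ≠ ∞) {D : Set (EuclideanSpace ℝ (Fin N))} (u : D → ℝ) :
    QuasiContinuous p Ω u ↔ ∀ r : ℝ, 0 < r → ∃ O : Set (EuclideanSpace ℝ (Fin N)),
      IsOpenInClosure Ω O ∧ (∃ w ∈ admissible p Ω O, ‖w‖ < r) ∧
        ContinuousOn u {x : D | (x : EuclideanSpace ℝ (Fin N)) ∉ O} := by
  have hp0 : 0 < p.toReal :=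
    ENNReal.toReal_pos (zero_lt_one.trans_le (Fact.out : 1 ≤ p)).ne' hp
  constructor
  · intro h r hr
    obtain ⟨O, hO, hc, hu⟩ := h (ENNReal.ofReal r ^ p.toReal)
      (ENNReal.rpow_pos (by simpa using hr) ENNReal.ofReal_ne_top)
    refine ⟨O, hO, ?_, hu⟩
    simp only [relCap, iInf_lt_iff] at hc
    obtain ⟨w, hw, hlt⟩ := hc
    refine ⟨w, hw, ?_⟩
    rw [ENNReal.rpow_lt_rpow_iff hp0, ← ofReal_norm, ENNReal.ofReal_lt_ofReal_iff hr] at hlt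
    exact hlt
  · intro h ε hε
    obtain ⟨δ, hδ, hδε⟩ := exists_between hε
    have hδt : δ ≠ ∞ := ne_top_of_lt hδε
    obtain ⟨O, hO, ⟨w, hw, hlt⟩, hu⟩ := h (δ ^ (p.toReal)⁻¹).toReal
      (ENNReal.toReal_pos (ENNReal.rpow_pos hδ hδt).ne'
        (ENNReal.rpow_ne_top_of_nonneg (by positivity) hδt))
    refine ⟨O, hO, ?_, hu⟩
    simp only [relCap, iInf_lt_iff]
    refine ⟨w, hw, lt_of_le_of_lt ?_ hδε⟩
    have h1 : ‖w‖ₑ ≤ δ ^ (p.toReal)⁻¹ := by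
      rw [← ofReal_norm]
      exact ENNReal.ofReal_le_of_le_toReal hlt.le
    calc ‖w‖ₑ ^ p.toReal ≤ (δ ^ (p.toReal)⁻¹) ^ p.toReal := ENNReal.rpow_le_rpow h1 hp0.le
      _ = δ := ENNReal.rpow_inv_rpow hp0.ne' δ

/-- Quasi continuity passes to smaller open sets. -/
theorem QuasiContinuous.restrict (hp : p ≠ ∞) (h : U ≤ V)
    {D : Set (EuclideanSpace ℝ (Fin N))} (hD : D ⊆ closure U) {u : D → ℝ}
    (hu : QuasiContinuous p V u) : QuasiContinuous p U u := by
  rw [quasiContinuous_iff hp] at hu ⊢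
  obtain ⟨T, hT⟩ := exists_clm_jet_restrict p h
  have hcl : closure (U : Set (EuclideanSpace ℝ (Fin N))) ⊆ closure V := closure_mono h
  intro r hr
  -- The summand `1` keeps the quotient meaningful when `T` is zero.
  obtain ⟨O, ⟨G, hG, rfl⟩, ⟨w, ⟨hw, O', ⟨G', hG', rfl⟩, hOO', hw1⟩, hwr⟩, hc⟩ :=
    hu (r / (‖T‖ + 1)) (by positivity)
  refine ⟨G ∩ closure U, ⟨G, hG, rfl⟩, ⟨T w, ⟨?_, G' ∩ closure U, ⟨G', hG', rfl⟩, ?_, ?_⟩, ?_⟩, ?_⟩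
  · rw [sobolevTilde_eq] at hw ⊢
    exact map_mem_closure T.continuous hw fun v hv => sobolevCc_restrict h hv (hT v)
  · exact fun x hx => ⟨(hOO' ⟨hx.1, hcl hx.2⟩).1, hx.2⟩
  · have h1 := ae_mono (Measure.restrict_mono (μ := (volume : Measure (EuclideanSpace ℝ (Fin N))))
      (show G' ∩ closure U ∩ U ⊆ G' ∩ closure V ∩ V from
        fun x hx => ⟨⟨hx.1.1, hcl hx.1.2⟩, h hx.2⟩) le_rfl) hw1
    have h2 := ae_mono (Measure.restrict_mono (μ := (volume : Measure (EuclideanSpace ℝ (Fin N))))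
      (show G' ∩ closure U ∩ U ⊆ (U : Set (EuclideanSpace ℝ (Fin N))) from fun x hx => hx.2) le_rfl)
      (hT w none)
    filter_upwards [h1, h2] with x h1 h2
    rwa [h2]
  · rw [lt_div_iff₀ (by positivity)] at hwr
    nlinarith [T.le_opNorm w, norm_nonneg w]
  · refine hc.mono fun x hx hx' => hx ⟨hx'.1, hD x.2⟩

end RelCap

end

/-! ### Smooth truncation, cutoffs and extension by zero. -/

noncomputable section

namespace RelCap

open Filter Topology

/-- A smooth approximation of the absolute value. -/
def softAbs (δ t : ℝ) : ℝ := √(t ^ 2 + δ ^ 2) - δ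

section SoftAbs

variable {δ : ℝ}

theorem contDiff_softAbs (hδ : 0 < δ) : ContDiff ℝ 1 (softAbs δ) := by
  refine ContDiff.sub (ContDiff.sqrt (by fun_prop) fun t => ?_) contDiff_const
  positivity

theorem softAbs_nonneg (δ t : ℝ) : 0 ≤ softAbs δ t := by
  rw [softAbs, sub_nonneg]
  exact Real.le_sqrt_of_sq_le (by nlinarith [sq_nonneg t])

/-- It forces the value `0` at `0`, which preserves compact support, and gives norm bounds
independent of `δ`. -/
theorem abs_softAbs_le (hδ : 0 < δ) (t : ℝ) : |softAbs δ t| ≤ |t| := by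
  rw [abs_of_nonneg (softAbs_nonneg δ t), softAbs, sub_le_iff_le_add]
  refine Real.sqrt_le_iff.2 ⟨by positivity, ?_⟩
  nlinarith [sq_abs t, abs_nonneg t]

/-- The loss against the true absolute value is at most `δ`, hence summable along a series with
summable parameters. -/
theorem le_softAbs (δ t : ℝ) : |t| - δ ≤ softAbs δ t := by
  rw [softAbs]
  gcongr
  exact Real.abs_le_sqrt (by nlinarith [sq_nonneg δ])

theorem abs_deriv_softAbs_le (hδ : 0 < δ) (t : ℝ) : |deriv (softAbs δ) t| ≤ 1 := by
  have hpos : 0 < t ^ 2 + δ ^ 2 := by positivity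
  have h : HasDerivAt (softAbs δ) (2 * t / (2 * √(t ^ 2 + δ ^ 2))) t := by
    have h1 : HasDerivAt (fun s : ℝ => s ^ 2 + δ ^ 2) (2 * t) t := by
      simpa using (hasDerivAt_pow 2 t).add_const (δ ^ 2)
    exact (h1.sqrt hpos.ne').sub_const δ
  rw [h.deriv, mul_div_mul_left _ _ two_ne_zero, abs_div, abs_of_pos (Real.sqrt_pos.2 hpos)]
  exact div_le_one_of_le₀ (Real.abs_le_sqrt (by nlinarith [sq_nonneg δ])) (Real.sqrt_nonneg _)

end SoftAbs

variable {N : ℕ} {p : ℝ≥0∞} [Fact (1 ≤ p)] {Ω U V : Opens (EuclideanSpace ℝ (Fin N))}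

theorem volume_restrict_top :
    (volume : Measure (EuclideanSpace ℝ (Fin N))).restrict
      ((⊤ : Opens (EuclideanSpace ℝ (Fin N))) : Set (EuclideanSpace ℝ (Fin N))) = volume := by
  simp

theorem ae_restrict_top_iff {P : EuclideanSpace ℝ (Fin N) → Prop} :
    (∀ᵐ x ∂(volume : Measure (EuclideanSpace ℝ (Fin N))).restrict
      ((⊤ : Opens (EuclideanSpace ℝ (Fin N))) : Set (EuclideanSpace ℝ (Fin N))), P x) ↔
      ∀ᵐ x ∂(volume : Measure (EuclideanSpace ℝ (Fin N))), P x := by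
  rw [volume_restrict_top]

/-- A cutoff function for an open set. -/
structure IsCutoff (U : Opens (EuclideanSpace ℝ (Fin N))) (η : EuclideanSpace ℝ (Fin N) → ℝ) :
    Prop where
  contDiff : ContDiff ℝ (⊤ : ℕ∞) η
  hasCompactSupport : HasCompactSupport η
  tsupport_subset : tsupport η ⊆ U

namespace IsCutoff

variable {η : EuclideanSpace ℝ (Fin N) → ℝ} (hη : IsCutoff U η)
include hη

theorem eq_zero {x : EuclideanSpace ℝ (Fin N)} (hx : x ∉ U) : η x = 0 :=
  image_eq_zero_of_notMem_tsupport fun h => hx (hη.tsupport_subset h)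

theorem fderiv_eq_zero {x : EuclideanSpace ℝ (Fin N)} (hx : x ∉ U) : fderiv ℝ η x = 0 :=
  image_eq_zero_of_notMem_tsupport fun h =>
    hx (hη.tsupport_subset (tsupport_fderiv_subset ℝ h))

theorem continuous_fderiv_apply (e : EuclideanSpace ℝ (Fin N)) :
    Continuous fun x => fderiv ℝ η x e :=
  (hη.contDiff.continuous_fderiv (by simp)).clm_apply continuous_const

theorem hasCompactSupport_fderiv_apply (e : EuclideanSpace ℝ (Fin N)) :
    HasCompactSupport fun x => fderiv ℝ η x e :=
  hη.hasCompactSupport.fderiv_apply ℝ e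

/-- A cutoff function and its partial derivatives are bounded. -/
theorem exists_bound : ∃ M : ℝ, 0 ≤ M ∧ ∀ x, |η x| ≤ M ∧
    ∀ i : Fin N, |fderiv ℝ η x (EuclideanSpace.single i (1 : ℝ))| ≤ M := by
  obtain ⟨M₁, h₁⟩ := hη.contDiff.continuous.bounded_above_of_compact_support hη.hasCompactSupport
  choose M₂ h₂ using fun i : Fin N =>
    (hη.continuous_fderiv_apply (EuclideanSpace.single i (1 : ℝ))).bounded_above_of_compact_support
      (hη.hasCompactSupport_fderiv_apply _)
  refine ⟨|M₁| + ∑ i, |M₂ i|, by positivity, fun x => ⟨?_, fun i => ?_⟩⟩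
  · have : (0 : ℝ) ≤ ∑ i, |M₂ i| := by positivity
    linarith [h₁ x, le_abs_self M₁, Real.norm_eq_abs (η x)]
  · have := Finset.single_le_sum (f := fun i => |M₂ i|) (fun i _ => abs_nonneg _)
      (Finset.mem_univ i)
    have h := h₂ i x
    rw [Real.norm_eq_abs] at h
    linarith [le_abs_self (M₂ i), abs_nonneg M₁]

/-- The product rule for cutoff functions, with extension by zero. -/
theorem hasWeakDirDeriv {w : LpJet p U} (hw : w ∈ sobolev p U) (i : Fin N) :
    HasWeakDirDeriv volume (EuclideanSpace.single i (1 : ℝ)) (fun x => η x * w none x)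
      (fun x => η x * w (some i) x +
        fderiv ℝ η x (EuclideanSpace.single i (1 : ℝ)) * w none x) := by
  intro φ hφ hφc
  set e : EuclideanSpace ℝ (Fin N) := EuclideanSpace.single i (1 : ℝ)
  -- `φ` need not be supported in `U`, but `η * φ` is, so it can be tested against `w`.
  let ψ : 𝓓(U, ℝ) := ⟨fun x => η x * φ x, hη.contDiff.mul hφ, hφc.mul_left,
    (tsupport_mul_subset_left).trans hη.tsupport_subset⟩
  have key := hw i ψ
  have hd : ∀ x, fderiv ℝ ψ x e = η x * fderiv ℝ φ x e + fderiv ℝ η x e * φ x := fun x => by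
    change fderiv ℝ (fun x => η x * φ x) x e = _
    rw [fderiv_fun_mul (hη.contDiff.differentiable (by simp) x) (hφ.differentiable (by simp) x)]
    simp [mul_comm]
  have hφe : Continuous fun x => fderiv ℝ φ x e :=
    (hφ.continuous_fderiv (by simp)).clm_apply continuous_const
  have i1 := integrable_lp_mul (p := p)
    ((volume : Measure (EuclideanSpace ℝ (Fin N))).restrict U)
    (ψ := fun x => η x * fderiv ℝ φ x e) (hη.contDiff.continuous.mul hφe) hη.hasCompactSupport.mul_right (w none)
  have i2 := integrable_lp_mul (p := p)
    ((volume : Measure (EuclideanSpace ℝ (Fin N))).restrict U)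
    (ψ := fun x => fderiv ℝ η x e * φ x) ((hη.continuous_fderiv_apply e).mul hφ.continuous)
    (hη.hasCompactSupport_fderiv_apply e).mul_right (w none)
  have i3 := integrable_lp_mul (p := p)
    ((volume : Measure (EuclideanSpace ℝ (Fin N))).restrict U)
    (ψ := fun x => η x * φ x) (hη.contDiff.continuous.mul hφ.continuous) hη.hasCompactSupport.mul_right (w (some i))
  rw [← setIntegral_eq_integral_of_forall_compl_eq_zero (s := U)
      (f := fun x => η x * w none x * fderiv ℝ φ x e) (fun x hx => by simp [hη.eq_zero hx]),
    ← setIntegral_eq_integral_of_forall_compl_eq_zero (s := U)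
      (f := fun x => (η x * w (some i) x + fderiv ℝ η x e * w none x) * φ x)
      (fun x hx => by simp [hη.eq_zero hx, hη.fderiv_eq_zero hx])]
  have k1 : ∫ x in (U : Set (EuclideanSpace ℝ (Fin N))), w none x * fderiv ℝ ψ x e =
      (∫ x in (U : Set (EuclideanSpace ℝ (Fin N))), w none x * (η x * fderiv ℝ φ x e)) +
      ∫ x in (U : Set (EuclideanSpace ℝ (Fin N))), w none x * (fderiv ℝ η x e * φ x) := by
    rw [← integral_add i1 i2]
    simp only [hd, mul_add]
  have k2 : ∫ x in (U : Set (EuclideanSpace ℝ (Fin N))),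
      (η x * w (some i) x + fderiv ℝ η x e * w none x) * φ x =
      (∫ x in (U : Set (EuclideanSpace ℝ (Fin N))), w (some i) x * (η x * φ x)) +
      ∫ x in (U : Set (EuclideanSpace ℝ (Fin N))), w none x * (fderiv ℝ η x e * φ x) := by
    rw [← integral_add i3 i2]
    congr 1; ext x; ring
  have k3 : ∫ x in (U : Set (EuclideanSpace ℝ (Fin N))), η x * w none x * fderiv ℝ φ x e =
      ∫ x in (U : Set (EuclideanSpace ℝ (Fin N))), w none x * (η x * fderiv ℝ φ x e) := by
    congr 1; ext x; ring
  rw [k1] at key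
  rw [k2, k3]
  change _ = -∫ x in (U : Set (EuclideanSpace ℝ (Fin N))), w (some i) x * (η x * φ x) at key
  linarith

/-- The chain rule asks for an integrable derivative; the compact supports of `η` and its
derivatives upgrade `L^p` to `L^1`. -/
theorem integrable_mul_add (w : LpJet p U) (i : Fin N) :
    Integrable (fun x => η x * w (some i) x +
        fderiv ℝ η x (EuclideanSpace.single i (1 : ℝ)) * w none x) volume := by
  have i1 := integrable_lp_mul (p := p)
    ((volume : Measure (EuclideanSpace ℝ (Fin N))).restrict U)
    (hη.continuous_fderiv_apply (EuclideanSpace.single i (1 : ℝ)))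
    (hη.hasCompactSupport_fderiv_apply _) (w none)
  have i2 := integrable_lp_mul (p := p)
    ((volume : Measure (EuclideanSpace ℝ (Fin N))).restrict U)
    hη.contDiff.continuous hη.hasCompactSupport (w (some i))
  rw [← integrableOn_iff_integrable_of_support_subset (s := U)]
  · refine (i2.add i1).congr (Eventually.of_forall fun x => ?_)
    simp [mul_comm]
  · intro x hx
    by_contra hxU
    exact hx (by simp [hη.eq_zero hxU, hη.fderiv_eq_zero hxU])

/-- The product of a cutoff function with a continuous function on `closure U`. -/
theorem exists_continuous_mul (f : C_c(closure (U : Set (EuclideanSpace ℝ (Fin N))), ℝ)) :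
    ∃ v : EuclideanSpace ℝ (Fin N) → ℝ, Continuous v ∧ HasCompactSupport v ∧
      (∀ x, x ∉ U → v x = 0) ∧
      ∀ x ∈ U, ∀ hx : x ∈ closure (U : Set (EuclideanSpace ℝ (Fin N))),
        v x = η x * f ⟨x, hx⟩ := by
  classical
  let F : EuclideanSpace ℝ (Fin N) → ℝ := fun x =>
    if hx : x ∈ closure (U : Set (EuclideanSpace ℝ (Fin N))) then f ⟨x, hx⟩ else 0
  have hF : ContinuousOn F U := by
    rw [continuousOn_iff_continuous_domRestrict]
    have : (U : Set (EuclideanSpace ℝ (Fin N))).domRestrict F =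
        f ∘ Set.inclusion (subset_closure (s := (U : Set (EuclideanSpace ℝ (Fin N))))) := by
      ext x
      exact dif_pos (subset_closure x.2)
    rw [this]
    exact f.continuous.comp (continuous_inclusion _)
  refine ⟨fun x => η x * F x, ?_, hη.hasCompactSupport.mul_right,
    fun x hx => by simp [hη.eq_zero hx], fun x _ hx => by simp [F, dif_pos hx]⟩
  refine continuous_iff_continuousAt.2 fun x => ?_
  by_cases hx : x ∈ tsupport η
  · exact hη.contDiff.continuous.continuousAt.mul
      (hF.continuousAt (U.isOpen.mem_nhds (hη.tsupport_subset hx)))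
  · have h0 : (fun x => η x * F x) =ᶠ[𝓝 x] fun _ => 0 := by
      filter_upwards [notMem_tsupport_iff_eventuallyEq.1 hx] with y hy
      simp [hy]
    exact continuousAt_const.congr h0.symm

end IsCutoff

/-- `L^p` bounds for a function vanishing outside `U`. -/
theorem eLpNorm_le_of_forall_notMem {p : ℝ≥0∞} {F f : EuclideanSpace ℝ (Fin N) → ℝ} {M : ℝ}
    (h0 : ∀ x, x ∉ U → F x = 0)
    (hF : ∀ᵐ x ∂(volume : Measure (EuclideanSpace ℝ (Fin N))).restrict U, |F x| ≤ M * |f x|) :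
    eLpNorm F p volume ≤
      ENNReal.ofReal M * eLpNorm f p ((volume : Measure (EuclideanSpace ℝ (Fin N))).restrict U) := by
  have hind : (U : Set (EuclideanSpace ℝ (Fin N))).indicator F = F :=
    Set.indicator_eq_self.2 fun x hx => by
      by_contra hxU
      exact hx (h0 x hxU)
  rw [← hind, eLpNorm_indicator_eq_eLpNorm_restrict U.isOpen.measurableSet]
  exact eLpNorm_le_mul_eLpNorm_of_ae_le_mul hF p

/-- Localization and smooth truncation of a continuous Sobolev function. -/
theorem IsCutoff.exists_softAbs_mul (p : ℝ≥0∞) [Fact (1 ≤ p)]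
    {η : EuclideanSpace ℝ (Fin N) → ℝ} (hη : IsCutoff U η) :
    ∃ C : ℝ, 0 ≤ C ∧ ∀ w ∈ sobolevCc p U, ∀ δ : ℝ, 0 < δ →
      ∃ W ∈ sobolevCc p (⊤ : Opens (EuclideanSpace ℝ (Fin N))), ‖W‖ ≤ C * ‖w‖ ∧ 0 ≤ W none ∧
        ∀ᵐ x ∂(volume : Measure (EuclideanSpace ℝ (Fin N))), |η x * w none x| - δ ≤ W none x := by
  obtain ⟨M, hM0, hM⟩ := hη.exists_bound
  obtain ⟨K, hK0, hK⟩ := exists_norm_jet_le p (⊤ : Opens (EuclideanSpace ℝ (Fin N)))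
  refine ⟨K * (M * 2), by positivity, ?_⟩
  rintro w ⟨hw, f, hf⟩ δ hδ
  obtain ⟨v, hvc, hvs, hv0, hv⟩ := hη.exists_continuous_mul f
  have hvw : v =ᵐ[volume] fun x => η x * w none x := by
    rw [ae_restrict_iff' U.isOpen.measurableSet] at hf
    filter_upwards [hf] with x hx
    by_cases hxU : x ∈ U
    · rw [hv x hxU (subset_closure hxU), hx hxU (subset_closure hxU)]
    · simp [hv0 x hxU, hη.eq_zero hxU]
  let e : Fin N → EuclideanSpace ℝ (Fin N) := fun i => EuclideanSpace.single i (1 : ℝ)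
  let G : Fin N → EuclideanSpace ℝ (Fin N) → ℝ := fun i x =>
    η x * w (some i) x + fderiv ℝ η x (e i) * w none x
  have hG : ∀ i, HasWeakDirDeriv volume (e i) v (G i) := by
    intro i φ hφ hφc
    rw [← hη.hasWeakDirDeriv hw i φ hφ hφc]
    exact integral_congr_ae (hvw.mul EventuallyEq.rfl)
  have hGi : ∀ i, Integrable (G i) volume := hη.integrable_mul_add w
  -- The jet of `softAbs δ (η w)`, with derivatives given by the product and chain rules.
  let F : Option (Fin N) → EuclideanSpace ℝ (Fin N) → ℝ := fun j => j.elim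
    (fun x => softAbs δ (v x)) (fun i x => deriv (softAbs δ) (v x) * G i x)
  have hFd : ∀ i, HasWeakDirDeriv volume (e i) (F none) (F (some i)) := fun i =>
    (hG i).comp hvc hvs (hGi i) (contDiff_softAbs hδ) (abs_softAbs_le hδ) (abs_deriv_softAbs_le hδ)
  have hFm : ∀ j, AEStronglyMeasurable (F j) volume := by
    rintro (_ | i)
    · exact ((contDiff_softAbs hδ).continuous.comp hvc).aestronglyMeasurable
    · exact (((contDiff_softAbs hδ).continuous_deriv le_rfl).comp
        hvc).aestronglyMeasurable.mul (hGi i).aestronglyMeasurable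
  have hF0 : ∀ j x, x ∉ U → F j x = 0 := by
    rintro (_ | i) x hx
    · have h := abs_softAbs_le hδ (v x)
      rw [hv0 x hx, abs_zero] at h
      simpa [F, hv0 x hx] using h
    · simp [F, G, hη.eq_zero hx, hη.fderiv_eq_zero hx]
  have hFb : ∀ j, ∀ᵐ x ∂(volume : Measure (EuclideanSpace ℝ (Fin N))).restrict U,
      |F j x| ≤ M * |‖w none x‖ + ‖w j x‖| := by
    intro j
    filter_upwards [ae_restrict_of_ae hvw] with x hx
    rw [abs_of_nonneg (add_nonneg (norm_nonneg (w none x)) (norm_nonneg (w j x))), Real.norm_eq_abs, Real.norm_eq_abs]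
    have h0 : |η x * w none x| ≤ M * |w none x| := by
      rw [abs_mul]
      exact mul_le_mul_of_nonneg_right (hM x).1 (abs_nonneg _)
    rcases j with _ | i
    · have h1 := abs_softAbs_le hδ (v x)
      rw [hx] at h1
      change |softAbs δ (v x)| ≤ _
      rw [hx]
      nlinarith [mul_nonneg hM0 (abs_nonneg (w none x))]
    · change |deriv (softAbs δ) (v x) * G i x| ≤ _
      rw [abs_mul]
      refine (mul_le_of_le_one_left (abs_nonneg _) (abs_deriv_softAbs_le hδ _)).trans ?_
      refine (abs_add_le _ _).trans ?_
      rw [abs_mul, abs_mul]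
      have h1 := mul_le_mul_of_nonneg_right (hM x).1 (abs_nonneg (w (some i) x))
      have h2 := mul_le_mul_of_nonneg_right ((hM x).2 i) (abs_nonneg (w none x))
      linarith
  have hwj : ∀ j, eLpNorm (fun x => ‖w j x‖) p
      ((volume : Measure (EuclideanSpace ℝ (Fin N))).restrict U) ≤ ENNReal.ofReal ‖w‖ := by
    intro j
    rw [eLpNorm_norm, ENNReal.le_ofReal_iff_toReal_le (Lp.eLpNorm_ne_top _) (norm_nonneg _),
      ← Lp.norm_def]
    exact PiLp.norm_apply_le w j
  have hFn : ∀ j, eLpNorm (F j) p volume ≤ ENNReal.ofReal (M * 2 * ‖w‖) := by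
    intro j
    refine (eLpNorm_le_of_forall_notMem (hF0 j) (hFb j)).trans ?_
    rw [mul_assoc, ENNReal.ofReal_mul hM0]
    gcongr
    refine (eLpNorm_add_le (Lp.aestronglyMeasurable _).norm (Lp.aestronglyMeasurable _).norm
      Fact.out).trans ?_
    rw [two_mul, ENNReal.ofReal_add (norm_nonneg _) (norm_nonneg _)]
    exact add_le_add (hwj _) (hwj _)
  have hFL : ∀ j, MemLp (F j) p ((volume : Measure (EuclideanSpace ℝ (Fin N))).restrict
      ((⊤ : Opens (EuclideanSpace ℝ (Fin N))) : Set (EuclideanSpace ℝ (Fin N)))) := fun j => by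
    rw [volume_restrict_top]
    exact ⟨hFm j, (hFn j).trans_lt ENNReal.ofReal_lt_top⟩
  let W : LpJet p (⊤ : Opens (EuclideanSpace ℝ (Fin N))) :=
    WithLp.toLp p fun j => (hFL j).toLp (F j)
  have hW : ∀ j, W j =ᵐ[(volume : Measure (EuclideanSpace ℝ (Fin N))).restrict
      ((⊤ : Opens (EuclideanSpace ℝ (Fin N))) : Set (EuclideanSpace ℝ (Fin N)))] F j :=
    fun j => (hFL j).coeFn_toLp
  have hWv : ∀ j, W j =ᵐ[volume] F j := fun j => ae_restrict_top_iff.1 (hW j)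
  refine ⟨W, ⟨fun i φ => ?_, ⟨⟨fun x => softAbs δ (v x), ?_⟩, ?_⟩, ?_⟩, ?_, ?_, ?_⟩
  · have h := hFd i φ φ.contDiff φ.hasCompactSupport
    rw [← volume_restrict_top] at h
    refine (integral_congr_ae ((hW none).mul EventuallyEq.rfl)).trans (h.trans (congrArg _ ?_))
    exact (integral_congr_ae ((hW (some i)).mul EventuallyEq.rfl)).symm
  · exact (contDiff_softAbs hδ).continuous.comp (hvc.comp continuous_subtype_val)
  · have h0 : softAbs δ 0 = 0 := by simpa using abs_softAbs_le hδ 0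
    exact (hvs.comp_left h0).comp_isClosedEmbedding isClosed_closure.isClosedEmbedding_subtypeVal
  · filter_upwards [hW none] with x hx _
    exact hx
  · rw [mul_assoc]
    refine hK W _ fun j => ?_
    change ‖(hFL j).toLp (F j)‖ ≤ _
    rw [Lp.norm_toLp]
    refine ENNReal.toReal_le_of_le_ofReal (by positivity) ?_
    rw [volume_restrict_top]
    exact hFn j
  · rw [← Lp.coeFn_nonneg]
    filter_upwards [hW none] with x hx
    rw [hx]
    exact softAbs_nonneg δ _
  · filter_upwards [hWv none, hvw] with x hx hx'
    rw [hx, ← hx']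
    exact le_softAbs δ _

end RelCap

end

/-! ### Localization of admissible functions and gluing over a countable cover. -/

noncomputable section

namespace RelCap

open Filter Topology

variable {N : ℕ} {p : ℝ≥0∞} [Fact (1 ≤ p)] {Ω U V : Opens (EuclideanSpace ℝ (Fin N))}

/-- The closure of `W^{1,p}(Ω) ∩ C_c(closure Ω)` contains the sums of its convergent series. -/
theorem mem_closure_sobolevCc_of_hasSum {X : ℕ → LpJet p Ω} {W : LpJet p Ω}
    (hX : ∀ n, X n ∈ closure (sobolevCc p Ω)) (h : HasSum X W) : W ∈ closure (sobolevCc p Ω) :=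
  isClosed_closure.mem_of_tendsto h (Eventually.of_forall fun _ =>
    (sobolevCcSubgroup p Ω).topologicalClosure.sum_mem fun n _ => hX n)

theorem hasSum_jet_apply {X : ℕ → LpJet p Ω} {W : LpJet p Ω} (h : HasSum X W)
    (j : Option (Fin N)) : HasSum (fun n => X n j) (W j) :=
  (PiLp.proj (𝕜 := ℝ) p (fun _ : Option (Fin N) =>
    Lp ℝ p ((volume : Measure (EuclideanSpace ℝ (Fin N))).restrict Ω)) j).hasSum h

/-- An element of the closure of `W^{1,p}(Ω) ∩ C_c(closure Ω)` is the sum of a rapidly convergent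
series. -/
theorem exists_series_of_mem_closure {w : LpJet p Ω} (hw : w ∈ closure (sobolevCc p Ω)) {r : ℝ}
    (hwr : ‖w‖ < r) : ∃ h : ℕ → LpJet p Ω, (∀ n, h n ∈ sobolevCc p Ω) ∧
      (∀ n, ‖h n‖ ≤ 2 * r * (1 / 2) ^ n) ∧
      Tendsto (fun n => ∑ k ∈ Finset.range (n + 1), h k) atTop (𝓝 w) := by
  have hr : 0 < r := (norm_nonneg w).trans_lt hwr
  obtain ⟨h, hlim, hmem, h0, hpos⟩ := controlled_sum_of_mem_closure (s := sobolevCcSubgroup p Ω)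
    hw (b := fun n => r * (1 / 2) ^ n) (fun n => by positivity)
  refine ⟨h, hmem, fun n => ?_, hlim⟩
  rcases n.eq_zero_or_pos with rfl | hn
  -- Only the first term is not small by construction; it is within `r` of `w`, whose norm is below
  -- `r`, whence the factor `2`.
  · have h1 : ‖h 0‖ ≤ ‖w‖ + ‖-h 0 + w‖ := by
      have := norm_sub_le w (-h 0 + w)
      simpa using this
    simp only [pow_zero, mul_one] at h0 ⊢
    linarith
  · have h1 : 0 < r * (1 / 2 : ℝ) ^ n := by positivity
    have := hpos n hn
    linarith

/-- Localization of a function in the closure of `W^{1,p}(U) ∩ C_c(closure U)`. -/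
theorem IsCutoff.exists_localization (p : ℝ≥0∞) [Fact (1 ≤ p)]
    {η : EuclideanSpace ℝ (Fin N) → ℝ} (hη : IsCutoff U η) :
    ∃ C : ℝ, 0 ≤ C ∧ ∀ w ∈ closure (sobolevCc p U), ∀ r : ℝ, ‖w‖ < r →
      ∃ W ∈ closure (sobolevCc p (⊤ : Opens (EuclideanSpace ℝ (Fin N)))),
        ‖W‖ ≤ C * r ∧ 0 ≤ W none ∧
        ∀ᵐ x ∂(volume : Measure (EuclideanSpace ℝ (Fin N))),
          x ∈ U → η x = 1 → 1 ≤ w none x → 1 ≤ W none x := by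
  obtain ⟨C, hC0, hC⟩ := hη.exists_softAbs_mul p
  -- The factor `8` is a product of three twos: the bound `2 * r` on the series, the doubling `X n +
  -- X n`, and the geometric sum.
  refine ⟨8 * C, by positivity, fun w hw r hwr => ?_⟩
  obtain ⟨h, hmem, hnorm, hlim⟩ := exists_series_of_mem_closure hw hwr
  choose X hX hXn hX0 hXη using fun n =>
    hC (h n) (hmem n) ((1 / 2) ^ n / 4) (by positivity)
  have hg : HasSum (fun n : ℕ => (4 * C * r) * (1 / 2 : ℝ) ^ n) (8 * C * r) := by
    rw [show 8 * C * r = 4 * C * r * 2 by ring]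
    exact hasSum_geometric_two.mul_left (4 * C * r)
  have hXb : ∀ n, ‖X n + X n‖ ≤ (4 * C * r) * (1 / 2 : ℝ) ^ n := fun n => by
    have h1 := mul_le_mul_of_nonneg_left (hnorm n) hC0
    linarith [norm_add_le (X n) (X n), hXn n]
  have hsum : Summable fun n => X n + X n := .of_norm_bounded hg.summable hXb
  set W := ∑' n, (X n + X n)
  have hWs : HasSum (fun n => X n + X n) W := hsum.hasSum
  have hWs0 := hasSum_jet_apply hWs none
  have hXX0 : ∀ n, 0 ≤ (X n + X n) none := fun n => add_nonneg (hX0 n) (hX0 n)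
  refine ⟨W, mem_closure_sobolevCc_of_hasSum (fun n => subset_closure
    ((sobolevCcSubgroup p _).add_mem (hX n) (hX n))) hWs, tsum_of_norm_bounded hg hXb,
    hWs0.nonneg hXX0, ?_⟩
  have hlim0 : Tendsto (fun n => ∑ k ∈ Finset.range (n + 1), h k none) atTop (𝓝 (w none)) := by
    have := ((PiLp.proj (𝕜 := ℝ) p (fun _ : Option (Fin N) =>
      Lp ℝ p ((volume : Measure (EuclideanSpace ℝ (Fin N))).restrict U)) none).continuous.tendsto
        w).comp hlim
    simpa [Function.comp_def] using this
  obtain ⟨ns, -, hns⟩ := (tendstoInMeasure_of_tendsto_Lp hlim0).exists_seq_tendsto_ae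
  have hpart : ∀ n, ∀ᵐ x ∂(volume : Measure (EuclideanSpace ℝ (Fin N))),
      ∑ k ∈ Finset.range (n + 1), (X k none x + X k none x) ≤ W none x := by
    intro n
    have h1 : ∑ k ∈ Finset.range (n + 1), (X k + X k) none ≤ W none :=
      sum_le_hasSum _ (fun k _ => hXX0 k) hWs0
    rw [← Lp.coeFn_le] at h1
    refine ae_restrict_top_iff.1 ?_
    filter_upwards [h1, Lp.coeFn_fun_finsetSum (Finset.range (n + 1)) fun k => (X k + X k) none,
      ae_all_iff.2 fun k => Lp.coeFn_add (X k none) (X k none)] with x h1 h2 h3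
    rw [h2] at h1
    refine le_of_eq_of_le (Finset.sum_congr rfl fun k _ => ?_) h1
    exact (h3 k).symm
  have hhs : ∀ n, ∀ᵐ x ∂(volume : Measure (EuclideanSpace ℝ (Fin N))).restrict U,
      (∑ k ∈ Finset.range (n + 1), h k none : Lp ℝ p _) x =
        ∑ k ∈ Finset.range (n + 1), h k none x := fun n =>
    Lp.coeFn_fun_finsetSum (Finset.range (n + 1)) fun k => h k none
  rw [ae_restrict_iff' U.isOpen.measurableSet] at hns
  filter_upwards [hns, ae_all_iff.2 hpart, ae_all_iff.2 hXη,
    ae_all_iff.2 fun n => (ae_restrict_iff' U.isOpen.measurableSet).1 (hhs n)]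
    with x h1 h2 h3 h4 hxU hηx hwx
  -- The truncation errors `(1 / 2) ^ k / 4` add up to at most `1 / 2`, hence to at most `1` after
  -- doubling. The doubling is what makes `2 * |w| - 1` at least `1` wherever `w` is.
  have hlow : ∀ n, 2 * |(∑ k ∈ Finset.range (n + 1), h k none : Lp ℝ p _) x| - 1 ≤ W none x := by
    intro n
    refine le_trans ?_ (h2 n)
    rw [h4 n hxU]
    have a1 := Finset.abs_sum_le_sum_abs (fun k => h k none x) (Finset.range (n + 1))
    have a2 : ∑ k ∈ Finset.range (n + 1), (|h k none x| - (1 / 2) ^ k / 4) ≤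
        ∑ k ∈ Finset.range (n + 1), X k none x :=
      Finset.sum_le_sum fun k _ => by simpa [hηx] using h3 k
    have a3 : ∑ k ∈ Finset.range (n + 1), (1 / 2 : ℝ) ^ k ≤ 2 :=
      sum_le_hasSum _ (fun k _ => by positivity) hasSum_geometric_two
    rw [Finset.sum_sub_distrib, ← Finset.sum_div] at a2
    rw [Finset.sum_add_distrib]
    linarith
  have hfin : 2 * |w none x| - 1 ≤ W none x :=
    le_of_tendsto (((h1 hxU).abs.const_mul 2).sub_const 1)
      (Eventually.of_forall fun n => hlow (ns n))
  linarith [le_abs_self (w none x)]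

/-- A nonempty open set is a countable union of balls whose concentric doubles stay inside. -/
theorem exists_ball_cover (hU : (U : Set (EuclideanSpace ℝ (Fin N))).Nonempty) :
    ∃ (c : ℕ → EuclideanSpace ℝ (Fin N)) (ρ : ℕ → ℝ), (∀ n, 0 < ρ n) ∧
      (∀ n, Metric.closedBall (c n) (2 * ρ n) ⊆ U) ∧ ∀ x ∈ U, ∃ n, x ∈ Metric.ball (c n) (ρ n) := by
  have hball : ∀ x : EuclideanSpace ℝ (Fin N), ∃ s : ℝ, 0 < s ∧
      (x ∈ U → Metric.closedBall x (2 * s) ⊆ U) := by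
    intro x
    by_cases hx : x ∈ U
    · obtain ⟨s, hs, hsU⟩ := Metric.nhds_basis_closedBall.mem_iff.1 (U.isOpen.mem_nhds hx)
      exact ⟨s / 2, by positivity, fun _ => by rwa [mul_div_cancel₀ s two_ne_zero]⟩
    · exact ⟨1, one_pos, fun h => (hx h).elim⟩
  choose s hs hsU using hball
  obtain ⟨t, htU, htc, ht⟩ := countable_cover_nhdsWithin
    (s := (U : Set (EuclideanSpace ℝ (Fin N)))) (f := fun x => Metric.ball x (s x))
    fun x _ => mem_nhdsWithin_of_mem_nhds (Metric.ball_mem_nhds x (hs x))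
  have htn : t.Nonempty := by
    obtain ⟨x, hx⟩ := hU
    obtain ⟨y, hy, -⟩ := Set.mem_iUnion₂.1 (ht hx)
    exact ⟨y, hy⟩
  obtain ⟨c, rfl⟩ := htc.exists_eq_range htn
  refine ⟨c, fun n => s (c n), fun n => hs _, fun n => hsU _ (htU ⟨n, rfl⟩), fun x hx => ?_⟩
  obtain ⟨_, ⟨n, rfl⟩, hn⟩ := Set.mem_iUnion₂.1 (ht hx)
  exact ⟨n, hn⟩

/-- Quasi continuity with respect to an open set implies quasi continuity with respect to the
whole space. -/
theorem QuasiContinuous.extend_top (hp : p ≠ ∞)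
    (hU : (U : Set (EuclideanSpace ℝ (Fin N))).Nonempty)
    {u : ↥(U : Set (EuclideanSpace ℝ (Fin N))) → ℝ} (hu : QuasiContinuous p U u) :
    QuasiContinuous p (⊤ : Opens (EuclideanSpace ℝ (Fin N))) u := by
  rw [quasiContinuous_iff hp] at hu ⊢
  intro r hr
  obtain ⟨c, ρ, hρ, hcU, hcov⟩ := exists_ball_cover hU
  let η : ∀ n, ContDiffBump (c n) := fun n => ⟨ρ n, 2 * ρ n, hρ n, by linarith [hρ n]⟩
  have hη : ∀ n, IsCutoff U (η n) := fun n =>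
    ⟨(η n).contDiff, (η n).hasCompactSupport, by rw [(η n).tsupport_eq]; exact hcU n⟩
  choose C hC0 hC using fun n => (hη n).exists_localization p
  -- The cutoff constants `C n` may be unbounded, so each tolerance absorbs its own; the localized
  -- norms then sum to at most `r / 2`.
  let s : ℕ → ℝ := fun n => r / 4 * (1 / 2) ^ n / (C n + 1)
  have hs : ∀ n, 0 < s n := fun n => by
    have := hC0 n
    positivity
  have hCs : ∀ n, C n * s n ≤ r / 4 * (1 / 2) ^ n := fun n => by
    have h0 := hC0 n
    have h1 : (0 : ℝ) ≤ r / 4 * (1 / 2) ^ n := by positivity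
    simp only [s]
    rw [mul_div_assoc', div_le_iff₀ (by positivity)]
    nlinarith
  choose O hO hw hcont using fun n => hu (s n) (hs n)
  choose w hwO hws using hw
  choose G hG hGO using hO
  choose W hWm hWn hW0 hW1 using fun n =>
    hC n (w n) (sobolevTilde_eq (p := p) (Ω := U) ▸ (hwO n).1) (s n) (hws n)
  have hg : HasSum (fun n : ℕ => r / 4 * (1 / 2 : ℝ) ^ n) (r / 2) := by
    rw [show r / 2 = r / 4 * 2 by ring]
    exact hasSum_geometric_two.mul_left (r / 4)
  have hWb : ∀ n, ‖W n‖ ≤ r / 4 * (1 / 2 : ℝ) ^ n := fun n => (hWn n).trans (hCs n)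
  have hWs : HasSum W (∑' n, W n) := (Summable.of_norm_bounded hg.summable hWb).hasSum
  have hWs0 := hasSum_jet_apply hWs none
  -- Cutting by the ball, on which `η n` equals `1`, makes the pieces open in the whole space and
  -- confines them to `U`.
  set A : Set (EuclideanSpace ℝ (Fin N)) := ⋃ n, G n ∩ Metric.ball (c n) (ρ n)
  have hAo : IsOpenInClosure (⊤ : Opens (EuclideanSpace ℝ (Fin N))) A :=
    ⟨A, isOpen_iUnion fun n => (hG n).inter Metric.isOpen_ball, by simp⟩
  have hballU : ∀ n, Metric.ball (c n) (ρ n) ⊆ (U : Set (EuclideanSpace ℝ (Fin N))) := fun n =>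
    (Metric.ball_subset_closedBall.trans
      (Metric.closedBall_subset_closedBall (by linarith [hρ n]))).trans (hcU n)
  refine ⟨A, hAo, ⟨∑' n, W n, ⟨?_, A, hAo, subset_rfl, ?_⟩, ?_⟩, ?_⟩
  · rw [sobolevTilde_eq]
    exact mem_closure_sobolevCc_of_hasSum hWm hWs
  · have hWle : ∀ n, ∀ᵐ x ∂(volume : Measure (EuclideanSpace ℝ (Fin N))),
        W n none x ≤ (∑' n, W n : LpJet p _) none x := fun n =>
      ae_restrict_top_iff.1 ((Lp.coeFn_le _ _).2 (le_hasSum hWs0 n fun k _ => hW0 k))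
    have hw1 : ∀ n, ∀ᵐ x ∂(volume : Measure (EuclideanSpace ℝ (Fin N))),
        x ∈ G n → x ∈ U → 1 ≤ w n none x := by
      intro n
      obtain ⟨-, O', ⟨G', hG', rfl⟩, hOO', h1⟩ := hwO n
      rw [ae_restrict_iff' ((hG'.measurableSet.inter isClosed_closure.measurableSet).inter
        U.isOpen.measurableSet)] at h1
      filter_upwards [h1] with x h1 hxG hxU
      refine h1 ⟨hOO' ?_, hxU⟩
      rw [hGO n]
      exact ⟨hxG, subset_closure hxU⟩
    refine (ae_restrict_iff' ?_).2 ?_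
    · exact (isOpen_iUnion fun n => (hG n).inter Metric.isOpen_ball).measurableSet.inter
        (Opens.isOpen _).measurableSet
    filter_upwards [ae_all_iff.2 hWle, ae_all_iff.2 hw1, ae_all_iff.2 hW1] with x h1 h2 h3 hx
    obtain ⟨n, hxG, hxB⟩ := Set.mem_iUnion.1 hx.1
    have hxU := hballU n hxB
    exact (h3 n hxU ((η n).one_of_mem_closedBall (Metric.ball_subset_closedBall hxB))
      (h2 n hxG hxU)).trans (h1 n)
  · exact (tsum_of_norm_bounded hg hWb).trans_lt (half_lt_self hr)
  -- Continuity is checked near `x` inside one ball of the cover; there a point of `U` outside `A`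
  -- is outside `O n`.
  · intro x hx
    obtain ⟨n, hn⟩ := hcov x x.2
    have hsub : {y : ↥(U : Set (EuclideanSpace ℝ (Fin N))) | (y : EuclideanSpace ℝ (Fin N)) ∉ A} ∩
        Subtype.val ⁻¹' Metric.ball (c n) (ρ n) ⊆
        {y | (y : EuclideanSpace ℝ (Fin N)) ∉ O n} := by
      rintro y ⟨hyA, hyB⟩ hyO
      rw [hGO n] at hyO
      exact hyA (Set.mem_iUnion.2 ⟨n, hyO.1, hyB⟩)
    have hnhds : Subtype.val ⁻¹' Metric.ball (c n) (ρ n) ∈ 𝓝 x :=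
      (Metric.isOpen_ball.preimage continuous_subtype_val).mem_nhds hn
    rw [← continuousWithinAt_inter hnhds]
    exact (hcont n x (hsub ⟨hx, hn⟩)).mono hsub

end RelCap

end

theorem mainTheorem10 {N : ℕ} (p : ℝ≥0∞) [Fact (1 ≤ p)] (hp : 1 < p) (hp' : p < ∞)
    (U V : Opens (EuclideanSpace ℝ (Fin N))) (hU : (U : Set (EuclideanSpace ℝ (Fin N))).Nonempty)
    (hUV : U ≤ V) (u : ↥(U : Set (EuclideanSpace ℝ (Fin N))) → ℝ) :
    RelCap.QuasiContinuous p U u ↔ RelCap.QuasiContinuous p V u :=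
  -- Up to the whole space, then down to `V`; no direct extension from `U` to `V` is needed.
  ⟨fun h => (h.extend_top hp'.ne hU).restrict hp'.ne le_top
      ((show (U : Set (EuclideanSpace ℝ (Fin N))) ⊆ V from hUV).trans subset_closure),
    fun h => h.restrict hp'.ne hUV subset_closure⟩
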